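/- Algebraic circuits over a field $\mathbb{F}$ are finite directed acyclic graphs whose leaves are labelled by variables or by elements of $\mathbb{F}$ and whose other nodes are addition or multiplication gates of unbounded fan-in; parallel edges are allowed. A circuit has one output gate and computes the formal polynomial obtained there. Its size is the number of nodes plus the number of edges, and its depth is the number of edges on a longest path from a leaf to the output gate. Let $\mathbf{x}=\mathbf{x}_1\sqcup\dots\sqcup\mathbf{x}_k$ be a partition of the variables into $k$ blocks $\mathbf{x}_i=(x_{i,1},\dots,x_{i,n})$ of size $n$. A polynomial $P\in\mathbb{F}[\mathbf{x}]$ is multi-symmetric with respect to this partition if $P(\pi_1(\mathbf{x}_1),\dots,\pi_k(\mathbf{x}_k))=P(\mathbf{x}_1,\dots,\mathbf{x}_k)$ for all permutations $\pi_1,\dots,\pi_k$ of the respective blocks. Write $\overline{\mathrm{Esym}}(\mathbf{x}_i)=(\mathrm{Esym}_1(\mathbf{x}_i),\dots,\mathrm{Esym}_n(\mathbf{x}_i))$, where $\mathrm{Esym}_r(\mathbf{x}_i)=\sum_{S\subseteq\{1,\dots,n\},\,|S|=r}\prod_{j\in S}x_{i,j}$. **Theorem (Complexity of multi-symmetric polynomials).**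 There are absolute constants $c,K,e\in\mathbb{N}$ with $c>0$ such that the following holds for all $k,n,d,s,\Delta\in\mathbb{N}$ and every field $\mathbb{F}$ with $|\mathbb{F}|\ge (nds)^c$. Let $P\in\mathbb{F}[\mathbf{x}]$ be multi-symmetric with respect to a partition $\mathbf{x}=\mathbf{x}_1\sqcup\dots\sqcup\mathbf{x}_k$ into blocks of size $n$, of total degree $d$ (with the zero polynomial given degree $0$), and computed by a circuit over $\mathbb{F}$ of size $s$ and depth $\Delta$. Then there is a unique polynomial $Q\in\mathbb{F}[z_{1,1},\dots,z_{k,n}]$ such that $$P(\mathbf{x})=Q\bigl(\overline{\mathrm{Esym}}(\mathbf{x}_1),\dots,\overline{\mathrm{Esym}}(\mathbf{x}_k)\bigr),$$ it has total degree at most $d$, and it is computed by a circuit over $\mathbb{F}$ of size at most $K\,(s+d+n)^K$ and depth at most $\Delta+e$. -/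

import Mathlib

open MvPolynomial

/-- A gate of an algebraic circuit over `F` in the variables `X` that may read the values of `m`
earlier gates: an input leaf (a variable or a field constant), or an addition or multiplication
gate of unbounded fan-in. A child may occur more than once in the list (parallel wires). -/
inductive CircuitGate (F : Type*) (X : Type*) (m : ℕ)
  | var (x : X)
  | const (a : F)
  | add (children : List (Fin m))
  | mul (children : List (Fin m))

namespace CircuitGate

variable {F X : Type*} {m : ℕ}

/-- The number of wires that enter the gate. -/
def fanIn : CircuitGate F X m → ℕ
  | var _ => 0
  | const _ => 0
  | add l => l.length
  | mul l => l.length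

/-- The polynomial computed by the gate, given the polynomials `v` computed by the earlier gates. -/
noncomputable def eval [CommSemiring F] (v : Fin m → MvPolynomial X F) :
    CircuitGate F X m → MvPolynomial X F
  | var x => MvPolynomial.X x
  | const a => MvPolynomial.C a
  | add l => (l.map v).sum
  | mul l => (l.map v).prod

/-- The depth of the gate (number of wires on a longest path from a leaf), given the depths `δ` of
the earlier gates. -/
def depth (δ : Fin m → ℕ) : CircuitGate F X m → ℕ
  | var _ => 0
  | const _ => 0
  | add l => (l.map δ).foldr max 0 + 1
  | mul l => (l.map δ).foldr max 0 + 1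

end CircuitGate

/-- A finite directed acyclic graph of `m` gates, listed in a topological order: every gate reads
only gates that precede it, and a gate may be read by any number of later gates. -/
inductive GateList (F : Type*) (X : Type*) : ℕ → Type _
  | nil : GateList F X 0
  | snoc {m : ℕ} (G : GateList F X m) (g : CircuitGate F X m) : GateList F X (m + 1)

namespace GateList

variable {F X : Type*}

/-- The number of gates plus the number of wires. -/
def size : {m : ℕ} → GateList F X m → ℕ
  | _, nil => 0
  | _, snoc G g => G.size + (1 + g.fanIn)

/-- The formal polynomial computed at each gate. -/
noncomputable def eval [CommSemiring F] : {m : ℕ} → GateList F X m → Fin m → MvPolynomial X F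
  | _, nil => fun i => i.elim0
  | _, snoc G g => Fin.snoc (α := fun _ => MvPolynomial X F) G.eval (g.eval G.eval)

/-- The depth of each gate. -/
def depth : {m : ℕ} → GateList F X m → Fin m → ℕ
  | _, nil => fun i => i.elim0
  | _, snoc G g => Fin.snoc (α := fun _ => ℕ) G.depth (g.depth G.depth)

end GateList

/-- An algebraic circuit over `F` in the variables `X`, with one output gate. -/
structure AlgebraicCircuit (F : Type*) (X : Type*) where
  /-- The number of gates, leaves included. -/
  numGates : ℕ
  /-- The gates. -/
  gates : GateList F X numGates
  /-- The output gate. -/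
  output : Fin numGates

namespace AlgebraicCircuit

variable {F X : Type*}

/-- The size of a circuit: the number of its gates (leaves included) plus the number of wires. -/
def size (C : AlgebraicCircuit F X) : ℕ := C.gates.size

/-- The depth of a circuit: the number of wires on a longest path from a leaf to the output. -/
def depth (C : AlgebraicCircuit F X) : ℕ := C.gates.depth C.output

/-- The circuit computes the polynomial `P` (as a formal polynomial). -/
def Computes [CommSemiring F] (C : AlgebraicCircuit F X) (P : MvPolynomial X F) : Prop :=
  C.gates.eval C.output = P

end AlgebraicCircuit

/-- `P` is multi-symmetric with respect to the partition of the variables `x_{i,j}` into the blocks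
`x_i = (x_{i,1}, …, x_{i,n})`, `i = 1, …, k`: it is invariant under all choices of permutations
`π_1, …, π_k` of the blocks. -/
def IsMultiSymmetric {F : Type*} [CommSemiring F] {k n : ℕ}
    (P : MvPolynomial (Fin k × Fin n) F) : Prop :=
  ∀ π : Fin k → Equiv.Perm (Fin n),
    rename (fun p : Fin k × Fin n => (p.1, π p.1 p.2)) P = P

/-- The elementary symmetric polynomial `Esym_r(x_i)` of the `i`-th block of variables. -/
noncomputable def blockEsym (F : Type*) [CommSemiring F] {k : ℕ} (n : ℕ) (i : Fin k) (r : ℕ) :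
    MvPolynomial (Fin k × Fin n) F :=
  rename (fun j : Fin n => (i, j)) (esymm (Fin n) F r)

/-- The composition `Q(Esym_1(x_1), …, Esym_n(x_1), …, Esym_1(x_k), …, Esym_n(x_k))`. The variable
with index `(i, r)`, where `r : Fin n` counts from `0`, is replaced by `Esym_{r+1}(x_i)`. -/
noncomputable def compEsym {F : Type*} [CommSemiring F] {k n : ℕ}
    (Q : MvPolynomial (Fin k × Fin n) F) : MvPolynomial (Fin k × Fin n) F :=
  bind₁ (fun p : Fin k × Fin n => blockEsym F n p.1 ((p.2 : ℕ) + 1)) Q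

-- Existence and uniqueness of `Q` come from the fundamental theorem on symmetric polynomials, one
-- block at a time. Giving `Esym_r` weight `r`, composition carries weighted components to
-- homogeneous components; being injective, it cannot cancel the top ones, whence the degree bound.
--
-- For the circuit, the idea is to recover the variables from their elementary symmetric functions.
-- The roots are not polynomials in the coefficients, but near a point `a` with distinct coordinates
-- they are power series in the increments of the coefficients. Truncations `ψ j` suffice: `P(ψ)`
-- agrees with the shifted `Q(z + Esym(a))` up to degree `d`
-- (`InvertsEsym.sub_mem_pow_idealOfVars`). As the latter has degree at most `d`, it is the part of
-- `P(ψ)` of degree at most `d`, extracted by interpolation over scalings of the variables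
-- (`exists_eq_sum_bind₁_C_mul_X`).
--
-- To keep the added depth constant, `ψ j` is given in closed form
-- (`Polynomial.exists_root_eq_sum_eval`). Let `f` have the roots `a i` and `p` the perturbed roots
-- `x i`. Then `x j - a j` is the residue of `(X - a j) p'/p` at `a j`. With `1/p` expanded as a
-- geometric series in `(f - p)/f`, this becomes a linear functional of a polynomial of bounded
-- degree, hence a combination of its values at fixed nodes. These values are built from linear
-- forms in the increments.

universe u

/-! ### Existence, uniqueness and degree of `Q`. -/

section FundamentalTheorem

theorem compEsym_C {F : Type*} [CommSemiring F] {k n : ℕ} (a : F) :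
    compEsym (C a : MvPolynomial (Fin k × Fin n) F) = C a := by
  simp [compEsym]

theorem compEsym_map {R S : Type*} [CommSemiring R] [CommSemiring S] {k n : ℕ} (f : R →+* S)
    (Q : MvPolynomial (Fin k × Fin n) R) : compEsym (map f Q) = map f (compEsym Q) := by
  simp only [compEsym, map_bind₁, blockEsym, map_rename, map_esymm]

/-- The polynomial ring in `k + 1` blocks of variables as the polynomial ring in the last `k`
blocks over the polynomial ring in the first block. -/
noncomputable def splitFirstBlock (R : Type*) [CommSemiring R] (k n : ℕ) :
    MvPolynomial (Fin (k + 1) × Fin n) R ≃ₐ[R]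
      MvPolynomial (Fin k × Fin n) (MvPolynomial (Fin n) R) :=
  (renameEquiv R
    { toFun := fun p => Fin.cases (motive := fun _ => (Fin k × Fin n) ⊕ Fin n)
        (Sum.inr p.2) (fun i => Sum.inl (i, p.2)) p.1
      invFun := Sum.elim (fun p => (p.1.succ, p.2)) (fun j => (0, j))
      left_inv := by
        rintro ⟨i, j⟩
        refine Fin.cases ?_ (fun i => ?_) i <;> simp
      right_inv := by
        rintro (⟨i, j⟩ | j) <;> simp }).trans (sumAlgEquiv R _ _)

section

variable {R : Type*} [CommSemiring R] {k n : ℕ}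

theorem splitFirstBlock_X_zero (j : Fin n) : splitFirstBlock R k n (X (0, j)) = C (X j) := by
  simp [splitFirstBlock]

theorem splitFirstBlock_X_succ (i : Fin k) (j : Fin n) :
    splitFirstBlock R k n (X (i.succ, j)) = X (i, j) := by
  simp [splitFirstBlock]

theorem splitFirstBlock_C (r : R) : splitFirstBlock R k n (C r) = C (C r) := by
  simp [splitFirstBlock]

theorem splitFirstBlock_rename (π : Fin (k + 1) → Equiv.Perm (Fin n))
    (P : MvPolynomial (Fin (k + 1) × Fin n) R) :
    splitFirstBlock R k n (rename (fun p => (p.1, π p.1 p.2)) P) =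
      rename (fun p => (p.1, π p.1.succ p.2))
        (map (rename (π 0)).toRingHom (splitFirstBlock R k n P)) := by
  induction P using MvPolynomial.induction_on with
  | C r => simp [splitFirstBlock_C]
  | add p q hp hq => simp only [map_add, hp, hq]
  | mul_X p x hp =>
    obtain ⟨i, j⟩ := x
    simp only [map_mul, hp, rename_X]
    congr 1
    refine Fin.cases ?_ (fun i => ?_) i
    · simp [splitFirstBlock_X_zero]
    · simp [splitFirstBlock_X_succ]

theorem splitFirstBlock_blockEsym_zero (r : ℕ) :
    splitFirstBlock R k n (blockEsym R n 0 r) = C (esymm (Fin n) R r) := by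
  simp only [blockEsym, esymm, map_sum, map_prod, rename_X, splitFirstBlock_X_zero]

theorem splitFirstBlock_blockEsym_succ (i : Fin k) (r : ℕ) :
    splitFirstBlock R k n (blockEsym R n i.succ r) = blockEsym (MvPolynomial (Fin n) R) n i r := by
  simp only [blockEsym, esymm, map_sum, map_prod, rename_X, splitFirstBlock_X_succ]

theorem splitFirstBlock_compEsym (Q : MvPolynomial (Fin (k + 1) × Fin n) R) :
    splitFirstBlock R k n (compEsym Q) =
      compEsym (map (bind₁ fun r : Fin n => esymm (Fin n) R (r + 1)).toRingHom
        (splitFirstBlock R k n Q)) := by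
  induction Q using MvPolynomial.induction_on with
  | C r => simp [splitFirstBlock_C, compEsym_C]
  | add p q hp hq =>
    simp only [compEsym, map_add] at hp hq ⊢
    rw [hp, hq]
  | mul_X p x hp =>
    obtain ⟨i, j⟩ := x
    simp only [compEsym, map_mul] at hp ⊢
    rw [hp]
    congr 1
    refine Fin.cases ?_ (fun i => ?_) i
    · simp [splitFirstBlock_X_zero, splitFirstBlock_blockEsym_zero]
    · simp [splitFirstBlock_X_succ, splitFirstBlock_blockEsym_succ]

end

theorem bind₁_esymm_injective (R : Type*) [CommRing R] (n : ℕ) :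
    Function.Injective (bind₁ fun r : Fin n => esymm (Fin n) R (r + 1)) := by
  intro p q h
  apply esymmAlgHom_fin_injective R (le_refl n)
  apply Subtype.ext
  simpa [esymmAlgHom_apply] using h

theorem MvPolynomial.IsSymmetric.exists_bind₁_esymm {R : Type*} [CommRing R] {n : ℕ}
    {p : MvPolynomial (Fin n) R} (hp : p.IsSymmetric) :
    ∃ q, bind₁ (fun r : Fin n => esymm (Fin n) R (r + 1)) q = p := by
  obtain ⟨q, hq⟩ := (esymmAlgHom_fin_bijective R n).2 ⟨p, hp⟩
  refine ⟨q, ?_⟩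
  have := congrArg Subtype.val hq
  simpa [esymmAlgHom_apply] using this

/-- Induction on `k` with the coefficient ring varying: the first block moves into the coefficients,
where the one-block case applies. -/
theorem compEsym_injective (k n : ℕ) : ∀ (R : Type*) [CommRing R],
    Function.Injective (compEsym : MvPolynomial (Fin k × Fin n) R → _) := by
  induction k with
  | zero =>
    intro R _ p q h
    rw [eq_C_of_isEmpty p, eq_C_of_isEmpty q] at h ⊢
    simpa [compEsym_C] using h
  | succ k ih =>
    intro R _ p q h
    have h' := congrArg (splitFirstBlock R k n) h
    rw [splitFirstBlock_compEsym, splitFirstBlock_compEsym] at h'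
    exact (splitFirstBlock R k n).injective
      (map_injective _ (bind₁_esymm_injective R n) (ih _ h'))

theorem IsMultiSymmetric.exists_compEsym {n : ℕ} (k : ℕ) : ∀ {R : Type*} [CommRing R]
    {P : MvPolynomial (Fin k × Fin n) R}, IsMultiSymmetric P → ∃ Q, P = compEsym Q := by
  induction k with
  | zero =>
    intro R _ P _
    exact ⟨P, by rw [eq_C_of_isEmpty P, compEsym_C]⟩
  | succ k ih =>
    intro R _ P hP
    obtain ⟨Q, hQ⟩ := ih (P := splitFirstBlock R k n P) (fun π => by
      have h := splitFirstBlock_rename (Fin.cons 1 π : Fin (k + 1) → Equiv.Perm (Fin n)) P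
      rw [hP] at h
      conv_rhs => rw [h]
      have h1 : (rename (R := R) (1 : Equiv.Perm (Fin n))).toRingHom = RingHom.id _ := by
        ext <;> simp
      rw [Fin.cons_zero, h1, MvPolynomial.map_id]
      simp)
    -- Permuting the first block fixes `compEsym Q`; by injectivity it fixes `Q`, hence every
    -- coefficient of `Q`.
    have hsym : ∀ m, (Q.coeff m).IsSymmetric := by
      intro m π
      have h := splitFirstBlock_rename (Fin.cons π 1 : Fin (k + 1) → Equiv.Perm (Fin n)) P
      rw [hP, hQ, Fin.cons_zero, ← compEsym_map] at h
      have h2 : compEsym (map (rename π).toRingHom Q) = compEsym Q := by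
        conv_rhs => rw [h]
        simp only [Fin.cons_succ, Pi.one_apply, Equiv.Perm.one_apply]
        exact (rename_id_apply _).symm
      have := congrArg (coeff m) (compEsym_injective k n _ h2)
      rw [coeff_map] at this
      exact this
    obtain ⟨Q', hQ'⟩ : ∃ Q', map (bind₁ fun r : Fin n => esymm (Fin n) R (r + 1)).toRingHom Q' = Q := by
      choose q hq using fun m => (hsym m).exists_bind₁_esymm
      refine ⟨∑ m ∈ Q.support, monomial m (q m), ?_⟩
      rw [map_sum]
      conv_rhs => rw [Q.as_sum]
      refine Finset.sum_congr rfl fun m _ => ?_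
      rw [map_monomial]
      congr 1
      exact hq m
    refine ⟨(splitFirstBlock R k n).symm Q', (splitFirstBlock R k n).injective ?_⟩
    rw [splitFirstBlock_compEsym, AlgEquiv.apply_symm_apply, hQ', hQ]

theorem blockEsym_isHomogeneous (F : Type*) [CommSemiring F] {k : ℕ} (n : ℕ) (i : Fin k) (r : ℕ) :
    (blockEsym F n i r).IsHomogeneous r := by
  refine IsHomogeneous.rename_isHomogeneous ?_
  rw [esymm]
  refine IsHomogeneous.sum _ _ _ fun s hs => ?_
  have := IsHomogeneous.prod s (fun i => (X i : MvPolynomial (Fin n) F)) (fun _ => 1)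
    (fun i _ => isHomogeneous_X F i)
  simpa [(Finset.mem_powersetCard.1 hs).2] using this

theorem compEsym_isHomogeneous {F : Type*} [CommSemiring F] {k n m : ℕ}
    {Q : MvPolynomial (Fin k × Fin n) F}
    (hQ : IsWeightedHomogeneous (fun p : Fin k × Fin n => (p.2 : ℕ) + 1) Q m) :
    (compEsym Q).IsHomogeneous m := by
  rw [compEsym, Q.as_sum, map_sum]
  refine IsHomogeneous.sum _ _ _ fun t ht => ?_
  rw [bind₁_monomial]
  have h := IsHomogeneous.prod t.support
    (fun p : Fin k × Fin n => blockEsym F n p.1 ((p.2 : ℕ) + 1) ^ t p)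
    (fun p => ((p.2 : ℕ) + 1) * t p) (fun p _ => (blockEsym_isHomogeneous F n _ _).pow _)
  have h2 : ∑ p ∈ t.support, ((p.2 : ℕ) + 1) * t p = m := by
    rw [← hQ (mem_support_iff.1 ht), Finsupp.weight_apply, Finsupp.sum]
    simp [mul_comm]
  rw [h2] at h
  exact h.C_mul _

/-- All weights `r + 1` are positive, so a monomial of `Q` has weight at least its degree. Its
weighted component has nonzero image, which is a homogeneous component of `compEsym Q`. -/
theorem totalDegree_le_totalDegree_compEsym {F : Type*} [CommRing F] {k n : ℕ}
    (Q : MvPolynomial (Fin k × Fin n) F) : Q.totalDegree ≤ (compEsym Q).totalDegree := by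
  set w : Fin k × Fin n → ℕ := fun p => (p.2 : ℕ) + 1 with hw
  have hcomp : ∀ m, compEsym (weightedHomogeneousComponent w m Q) =
      homogeneousComponent m (compEsym Q) := by
    intro m
    have hfin : (Function.support fun j => weightedHomogeneousComponent w j Q).Finite :=
      weightedHomogeneousComponent_finsupp Q
    have hsum : Q = ∑ j ∈ hfin.toFinset, weightedHomogeneousComponent w j Q := by
      conv_lhs => rw [← sum_weightedHomogeneousComponent w Q, finsum_eq_sum _ hfin]
    conv_rhs => rw [hsum, compEsym, map_sum, map_sum]
    have hone : ∀ j, homogeneousComponent m (bind₁ (fun p : Fin k × Fin n =>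
        blockEsym F n p.1 ((p.2 : ℕ) + 1)) (weightedHomogeneousComponent w j Q)) =
        if j = m then compEsym (weightedHomogeneousComponent w m Q) else 0 := by
      intro j
      change homogeneousComponent m (compEsym (weightedHomogeneousComponent w j Q)) = _
      rw [homogeneousComponent_of_mem (n := j) ((mem_homogeneousSubmodule _ _).2
        (compEsym_isHomogeneous (weightedHomogeneousComponent_isWeightedHomogeneous j Q)))]
      split_ifs with h1 h2 h2
      · rw [h1]
      · exact absurd h1.symm h2
      · exact absurd h2.symm h1
      · rfl
    rw [Finset.sum_congr rfl fun j _ => hone j, Finset.sum_ite_eq']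
    split_ifs with h
    · rfl
    · have : weightedHomogeneousComponent w m Q = 0 := by
        rw [Set.Finite.mem_toFinset] at h
        exact Function.notMem_support.1 h
      rw [this, compEsym, map_zero]
  rw [totalDegree, Finset.sup_le_iff]
  intro t ht
  by_contra! hlt
  have hdeg : (compEsym Q).totalDegree < Finsupp.weight w t := by
    refine hlt.trans_le ?_
    rw [Finsupp.weight_apply]
    refine Finset.sum_le_sum fun p _ => ?_
    simp only [hw, smul_eq_mul]
    exact Nat.le_mul_of_pos_right _ (Nat.succ_pos _)
  have h0 := hcomp (Finsupp.weight w t)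
  rw [homogeneousComponent_eq_zero _ _ hdeg] at h0
  have h1 : weightedHomogeneousComponent w (Finsupp.weight w t) Q = 0 :=
    compEsym_injective k n F (by rw [h0, compEsym, map_zero])
  have h2 := congrArg (coeff t) h1
  rw [coeff_weightedHomogeneousComponent, if_pos rfl, coeff_zero] at h2
  exact mem_support_iff.1 ht h2

end FundamentalTheorem

/-! ### Calculus of circuit size and depth. -/

section Circuits

theorem List.le_foldr_max {l : List ℕ} {x : ℕ} (h : x ∈ l) : x ≤ l.foldr max 0 := by
  induction l with
  | nil => simp at h
  | cons a l ih =>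
    rcases List.mem_cons.1 h with rfl | h
    · exact le_max_left _ _
    · exact (ih h).trans (le_max_right _ _)

namespace GateList

variable {F X : Type*} [CommSemiring F] {m m' m'' : ℕ}

/-- Some gate of depth at most `δ` computes the polynomial `p`. -/
def Reaches (G : GateList F X m) (p : MvPolynomial X F) (δ : ℕ) : Prop :=
  ∃ i, G.eval i = p ∧ G.depth i ≤ δ

/-- Whatever `G` computes is computed by `G'` in the same depth. -/
def ExtendsTo (G : GateList F X m) (G' : GateList F X m') : Prop :=
  ∀ p δ, G.Reaches p δ → G'.Reaches p δ

theorem Reaches.mono {G : GateList F X m} {p : MvPolynomial X F} {δ δ' : ℕ}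
    (h : G.Reaches p δ) (hδ : δ ≤ δ') : G.Reaches p δ' := by
  obtain ⟨i, hi, hd⟩ := h
  exact ⟨i, hi, hd.trans hδ⟩

theorem ExtendsTo.refl (G : GateList F X m) : G.ExtendsTo G := fun _ _ h => h

theorem ExtendsTo.trans {G : GateList F X m} {G' : GateList F X m'} {G'' : GateList F X m''}
    (h : G.ExtendsTo G') (h' : G'.ExtendsTo G'') : G.ExtendsTo G'' :=
  fun p δ hp => h' p δ (h p δ hp)

theorem extendsTo_snoc (G : GateList F X m) (g : CircuitGate F X m) : G.ExtendsTo (G.snoc g) := by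
  rintro p δ ⟨i, hi, hd⟩
  exact ⟨i.castSucc, by simpa [eval] using hi, by simpa [depth] using hd⟩

theorem reaches_snoc (G : GateList F X m) (g : CircuitGate F X m) :
    (G.snoc g).Reaches (g.eval G.eval) (g.depth G.depth) :=
  ⟨Fin.last m, by simp [eval], by simp [depth]⟩

theorem exists_children (G : GateList F X m) {l : List (MvPolynomial X F)} {δ : ℕ}
    (h : ∀ p ∈ l, G.Reaches p δ) :
    ∃ ch : List (Fin m), ch.map G.eval = l ∧ (ch.map G.depth).foldr max 0 ≤ δ := by
  induction l with
  | nil => exact ⟨[], rfl, by simp⟩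
  | cons p l ih =>
    obtain ⟨ch, h1, h2⟩ := ih fun q hq => h q (by simp [hq])
    obtain ⟨i, hi, hd⟩ := h p (by simp)
    exact ⟨i :: ch, by simp [hi, h1], by simpa using ⟨hd, h2⟩⟩

theorem exists_snoc_add (G : GateList F X m) {l : List (MvPolynomial X F)} {δ : ℕ}
    (h : ∀ p ∈ l, G.Reaches p δ) :
    ∃ G' : GateList F X (m + 1), G.ExtendsTo G' ∧ G'.Reaches l.sum (δ + 1) ∧
      G'.size = G.size + (1 + l.length) := by
  obtain ⟨ch, h1, h2⟩ := G.exists_children h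
  refine ⟨G.snoc (.add ch), G.extendsTo_snoc _, ?_, ?_⟩
  · have := (G.reaches_snoc (.add ch)).mono (Nat.succ_le_succ h2)
    rwa [CircuitGate.eval, h1] at this
  · simp [size, CircuitGate.fanIn, ← h1]

theorem exists_snoc_mul (G : GateList F X m) {l : List (MvPolynomial X F)} {δ : ℕ}
    (h : ∀ p ∈ l, G.Reaches p δ) :
    ∃ G' : GateList F X (m + 1), G.ExtendsTo G' ∧ G'.Reaches l.prod (δ + 1) ∧
      G'.size = G.size + (1 + l.length) := by
  obtain ⟨ch, h1, h2⟩ := G.exists_children h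
  refine ⟨G.snoc (.mul ch), G.extendsTo_snoc _, ?_, ?_⟩
  · have := (G.reaches_snoc (.mul ch)).mono (Nat.succ_le_succ h2)
    rwa [CircuitGate.eval, h1] at this
  · simp [size, CircuitGate.fanIn, ← h1]

end GateList

open GateList

variable {F X Y : Type*} [CommSemiring F]

/-- The polynomial `p` can be computed in depth `δ` by adding gates and wires of total number at
most `c` to any given list of gates. -/
def IsCheap (p : MvPolynomial X F) (c δ : ℕ) : Prop :=
  ∀ (m : ℕ) (G : GateList F X m), ∃ (m' : ℕ) (G' : GateList F X m'),
    G.ExtendsTo G' ∧ G'.Reaches p δ ∧ G'.size ≤ G.size + c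

namespace IsCheap

variable {p q : MvPolynomial X F} {c c' δ δ' : ℕ}

theorem mono (h : IsCheap p c δ) (hc : c ≤ c') (hδ : δ ≤ δ') : IsCheap p c' δ' := by
  intro m G
  obtain ⟨m', G', h1, h2, h3⟩ := h m G
  exact ⟨m', G', h1, h2.mono hδ, h3.trans (by omega)⟩

theorem var (x : X) : IsCheap (MvPolynomial.X x : MvPolynomial X F) 1 0 := fun _ G =>
  ⟨_, G.snoc (.var x), G.extendsTo_snoc _, G.reaches_snoc (.var x), by
    simp [GateList.size, CircuitGate.fanIn]⟩

theorem const (a : F) : IsCheap (C a : MvPolynomial X F) 1 0 := fun _ G =>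
  ⟨_, G.snoc (.const a), G.extendsTo_snoc _, G.reaches_snoc (.const a), by
    simp [GateList.size, CircuitGate.fanIn]⟩

theorem exists_list {l : List (MvPolynomial X F)} (h : ∀ p ∈ l, IsCheap p c δ) {m : ℕ}
    (G : GateList F X m) : ∃ (m' : ℕ) (G' : GateList F X m'),
      G.ExtendsTo G' ∧ (∀ p ∈ l, G'.Reaches p δ) ∧ G'.size ≤ G.size + l.length * c := by
  induction l with
  | nil => exact ⟨m, G, .refl G, by simp, by simp⟩
  | cons p l ih =>
    obtain ⟨m₁, G₁, h1, h2, h3⟩ := ih fun q hq => h q (by simp [hq])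
    obtain ⟨m₂, G₂, h4, h5, h6⟩ := h p (by simp) m₁ G₁
    refine ⟨m₂, G₂, h1.trans h4, ?_, ?_⟩
    · intro q hq
      rcases List.mem_cons.1 hq with rfl | hq
      · exact h5
      · exact h4 _ _ (h2 q hq)
    · rw [List.length_cons, add_mul]
      omega

theorem list_sum {l : List (MvPolynomial X F)} (h : ∀ p ∈ l, IsCheap p c δ) :
    IsCheap l.sum (l.length * (c + 1) + 1) (δ + 1) := by
  intro m G
  obtain ⟨m₁, G₁, h1, h2, h3⟩ := exists_list h G
  obtain ⟨G₂, h4, h5, h6⟩ := G₁.exists_snoc_add h2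
  exact ⟨_, G₂, h1.trans h4, h5, by rw [h6, mul_add]; omega⟩

theorem list_prod {l : List (MvPolynomial X F)} (h : ∀ p ∈ l, IsCheap p c δ) :
    IsCheap l.prod (l.length * (c + 1) + 1) (δ + 1) := by
  intro m G
  obtain ⟨m₁, G₁, h1, h2, h3⟩ := exists_list h G
  obtain ⟨G₂, h4, h5, h6⟩ := G₁.exists_snoc_mul h2
  exact ⟨_, G₂, h1.trans h4, h5, by rw [h6, mul_add]; omega⟩

theorem finset_sum {ι : Type*} (s : Finset ι) {f : ι → MvPolynomial X F}
    (h : ∀ i ∈ s, IsCheap (f i) c δ) :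
    IsCheap (∑ i ∈ s, f i) (s.card * (c + 1) + 1) (δ + 1) := by
  have := list_sum (l := s.toList.map f) (c := c) (δ := δ) (by
    intro p hp
    obtain ⟨i, hi, rfl⟩ := List.mem_map.1 hp
    exact h i (Finset.mem_toList.1 hi))
  simpa using this

theorem add (hp : IsCheap p c δ) (hq : IsCheap q c δ) :
    IsCheap (p + q) (2 * (c + 1) + 1) (δ + 1) := by
  simpa using list_sum (l := [p, q]) (c := c) (δ := δ) (by simp [hp, hq])

theorem mul (hp : IsCheap p c δ) (hq : IsCheap q c δ) :
    IsCheap (p * q) (2 * (c + 1) + 1) (δ + 1) := by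
  simpa using list_prod (l := [p, q]) (c := c) (δ := δ) (by simp [hp, hq])

theorem pow (hp : IsCheap p c δ) (n : ℕ) :
    IsCheap (p ^ n) (n * (c + 1) + 1) (δ + 1) := by
  simpa using list_prod (l := List.replicate n p) (c := c) (δ := δ)
    (fun q hq => by rw [List.eq_of_mem_replicate hq]; exact hp)

/-- The gates of `H` are copied, with a computation of `θ x` in place of each leaf `x`. The cost is
charged to the leaves of `H` and not to the variables, which is why the final bound does not involve
`k`. -/
theorem exists_bind₁ {θ : X → MvPolynomial Y F} (hθ : ∀ x, IsCheap (θ x) c δ) {m : ℕ}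
    (H : GateList F X m) {m₀ : ℕ} (G : GateList F Y m₀) :
    ∃ (m' : ℕ) (G' : GateList F Y m'), G.ExtendsTo G' ∧
      (∀ i, G'.Reaches (bind₁ θ (H.eval i)) (H.depth i + δ)) ∧
      G'.size ≤ G.size + H.size * (c + 1) := by
  induction H with
  | nil => exact ⟨m₀, G, .refl G, fun i => i.elim0, by simp⟩
  | @snoc m H g ih =>
    obtain ⟨m₁, G₁, h1, h2, h3⟩ := ih
    suffices h : ∃ (m' : ℕ) (G' : GateList F Y m'), G₁.ExtendsTo G' ∧
        G'.Reaches (bind₁ θ (g.eval H.eval)) (g.depth H.depth + δ) ∧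
        G'.size ≤ G₁.size + (1 + g.fanIn) * (c + 1) by
      obtain ⟨m₂, G₂, h4, h5, h6⟩ := h
      refine ⟨m₂, G₂, h1.trans h4, fun i => ?_, ?_⟩
      · refine Fin.lastCases ?_ (fun i => ?_) i
        · simpa [GateList.eval, GateList.depth] using h5
        · simpa [GateList.eval, GateList.depth] using h4 _ _ (h2 i)
      · rw [GateList.size, add_mul]
        omega
    cases g with
    | var x =>
      obtain ⟨m₂, G₂, h4, h5, h6⟩ := hθ x m₁ G₁
      refine ⟨m₂, G₂, h4, ?_, ?_⟩
      · simpa [CircuitGate.eval, CircuitGate.depth] using h5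
      · simp only [CircuitGate.fanIn]
        omega
    | const a =>
      obtain ⟨m₂, G₂, h4, h5, h6⟩ := IsCheap.const (X := Y) a m₁ G₁
      refine ⟨m₂, G₂, h4, ?_, ?_⟩
      · simpa [CircuitGate.eval] using h5.mono (Nat.zero_le _)
      · simp only [CircuitGate.fanIn]
        omega
    | add l =>
      obtain ⟨G₂, h4, h5, h6⟩ := G₁.exists_snoc_add
        (l := l.map fun i => bind₁ θ (H.eval i)) (δ := (l.map H.depth).foldr max 0 + δ) (by
          intro p hp
          obtain ⟨i, hi, rfl⟩ := List.mem_map.1 hp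
          exact (h2 i).mono (Nat.add_le_add_right
            (List.le_foldr_max (List.mem_map_of_mem hi)) _))
      refine ⟨_, G₂, h4, ?_, ?_⟩
      · convert h5 using 1
        · simp [CircuitGate.eval, map_list_sum, Function.comp_def]
        · simp only [CircuitGate.depth]
          omega
      · rw [h6, List.length_map, CircuitGate.fanIn]
        exact Nat.add_le_add_left (Nat.le_mul_of_pos_right _ (Nat.succ_pos _)) _
    | mul l =>
      obtain ⟨G₂, h4, h5, h6⟩ := G₁.exists_snoc_mul
        (l := l.map fun i => bind₁ θ (H.eval i)) (δ := (l.map H.depth).foldr max 0 + δ) (by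
          intro p hp
          obtain ⟨i, hi, rfl⟩ := List.mem_map.1 hp
          exact (h2 i).mono (Nat.add_le_add_right
            (List.le_foldr_max (List.mem_map_of_mem hi)) _))
      refine ⟨_, G₂, h4, ?_, ?_⟩
      · convert h5 using 1
        · simp [CircuitGate.eval, map_list_prod, Function.comp_def]
        · simp only [CircuitGate.depth]
          omega
      · rw [h6, List.length_map, CircuitGate.fanIn]
        exact Nat.add_le_add_left (Nat.le_mul_of_pos_right _ (Nat.succ_pos _)) _

theorem bind₁ {θ : X → MvPolynomial Y F} (hθ : ∀ x, IsCheap (θ x) c δ)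
    {A : AlgebraicCircuit F X} (hA : A.Computes p) :
    IsCheap (MvPolynomial.bind₁ θ p) (A.size * (c + 1)) (A.depth + δ) := by
  intro m G
  obtain ⟨m', G', h1, h2, h3⟩ := exists_bind₁ hθ A.gates G
  exact ⟨m', G', h1, hA ▸ h2 A.output, h3⟩

theorem exists_circuit (hp : IsCheap p c δ) :
    ∃ A : AlgebraicCircuit F X, A.Computes p ∧ A.size ≤ c ∧ A.depth ≤ δ := by
  obtain ⟨m, G, -, ⟨i, h1, h2⟩, h3⟩ := hp 0 .nil
  exact ⟨⟨m, G, i⟩, h1, by simpa [GateList.size, AlgebraicCircuit.size] using h3, h2⟩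

end IsCheap

end Circuits

/-! ### A residue formula for perturbed roots. -/

section RootFormula

-- Here `S / f ^ (d + 1)` is the geometric series for `1 / P`, finite by nilpotency, and `H` inverts
-- `h ^ (d + 1)` modulo `τ ^ (d + 1)`. The coefficient is thus that of `τ ^ (-2)` in `P' / P`. The
-- summand `1 / (τ - y)` contributes `y`, and the other roots contribute no pole at `a j`.
open Polynomial in
theorem Polynomial.coeff_taylor_derivative_prod_X_sub_C {F R ι : Type*} [Field F] [CommRing R]
    [Algebra F R] [Fintype ι] [DecidableEq ι] {a : ι → F} (ha : Function.Injective a) {x : ι → R}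
    {I : Ideal R} {d : ℕ} (hd : 0 < d) (hI : I ^ (d + 1) = ⊥)
    (hx : ∀ i, x i - algebraMap F R (a i) ∈ I) (j : ι) {H : F[X]}
    (hH : (X - C (a j)) ^ (d + 1) ∣ (∏ i ∈ Finset.univ.erase j, (X - C (a i))) ^ (d + 1) * H - 1) :
    (taylor (algebraMap F R (a j)) (derivative (∏ i, (X - C (x i))) *
      (∑ m ∈ Finset.range (d + 1),
        ((∏ i, (X - C (a i))).map (algebraMap F R) - ∏ i, (X - C (x i))) ^ m *
          (∏ i, (X - C (a i))).map (algebraMap F R) ^ (d - m)) *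
      H.map (algebraMap F R))).coeff (d - 1) = x j - algebraMap F R (a j) := by
  set φ := algebraMap F R with hφ
  set f : R[X] := (∏ i, (X - C (a i))).map φ with hf
  set P : R[X] := ∏ i, (X - C (x i)) with hP
  set S : R[X] := ∑ m ∈ Finset.range (d + 1), (f - P) ^ m * f ^ (d - m) with hS
  set h : R[X] := (∏ i ∈ Finset.univ.erase j, (X - C (a i))).map φ with hh
  set q : R[X] := ∏ i ∈ Finset.univ.erase j, (X - C (x i)) with hq
  set τ : R[X] := X - C (φ (a j)) with hτ
  set y := x j - φ (a j) with hy
  set A : R[X] := ∑ m ∈ Finset.range (d + 1), C y ^ m * τ ^ (d - m) with hA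
  have hPq : P = (X - C (x j)) * q := (Finset.mul_prod_erase _ _ (Finset.mem_univ j)).symm
  have hfh : f = τ * h := by
    rw [hf, ← Finset.mul_prod_erase _ _ (Finset.mem_univ j), Polynomial.map_mul]
    simp [hτ, hh]
  have hτy : X - C (x j) = τ - C y := by rw [hτ, hy, C_sub, sub_sub_sub_cancel_right]
  have hpow : ∀ z ∈ I, z ^ (d + 1) = 0 := fun z hz => by
    have := Ideal.pow_mem_pow hz (d + 1)
    rwa [hI, Ideal.mem_bot] at this
  have hg : (f - P) ^ (d + 1) = 0 := by
    have hmem : f - P ∈ I.map (C : R →+* R[X]) := by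
      rw [← Ideal.Quotient.eq, hf, hP, Polynomial.map_prod, map_prod, map_prod]
      refine Finset.prod_congr rfl fun i _ => ?_
      rw [Ideal.Quotient.eq]
      have : Polynomial.map φ (X - C (a i)) - (X - C (x i)) = C (x i - φ (a i)) := by
        simp
      rw [this]
      exact Ideal.mem_map_of_mem _ (hx i)
    have := Ideal.pow_mem_pow hmem (d + 1)
    rwa [← Ideal.map_pow, hI, Ideal.map_bot, Ideal.mem_bot] at this
  have hPS : P * S = f ^ (d + 1) := by
    have := geom_sum₂_mul (f - P) f (d + 1)
    simp only [Nat.add_sub_cancel, hg] at this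
    rw [← hS] at this
    linear_combination -this
  have hτA : (X - C (x j)) * A = τ ^ (d + 1) := by
    have := geom_sum₂_mul (C y) τ (d + 1)
    simp only [Nat.add_sub_cancel, ← C_pow, hpow y (hx j)] at this
    simp only [C_pow] at this
    rw [← hA, C_0] at this
    rw [hτy]
    linear_combination -this
  -- `R` may have zero divisors, but the monic factor `X - C (x j)` can be cancelled.
  have hqS : q * S = A * h ^ (d + 1) := by
    refine (monic_X_sub_C (x j)).isRegular.left ?_
    simp only
    rw [← mul_assoc, ← hPq, hPS, ← mul_assoc, hτA, hfh, mul_pow]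
  -- For `i ≠ j`, `a j - x i` is the unit `a j - a i` plus a nilpotent element.
  have hcop : IsCoprime (τ ^ (d + 1)) q := by
    refine IsCoprime.pow_left (IsCoprime.prod_right fun i hi => ?_)
    refine isCoprime_X_sub_C_of_isUnit_sub ?_
    have h1 : IsUnit (φ (a j - a i)) :=
      (isUnit_iff_ne_zero.2 (sub_ne_zero.2 fun h => Finset.ne_of_mem_erase hi (ha h.symm))).map φ
    have h2 : IsNilpotent (-(x i - φ (a i))) := ⟨d + 1, hpow _ (I.neg_mem (hx i))⟩
    have h3 := h2.isUnit_add_left_of_commute h1 (Commute.all _ _)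
    convert h3 using 1
    rw [map_sub]
    abel
  have hdvd : τ ^ (d + 1) ∣ (X - C (x j)) * derivative q * S := by
    refine hcop.dvd_of_dvd_mul_left ⟨derivative q * h ^ (d + 1), ?_⟩
    calc q * ((X - C (x j)) * derivative q * S) = derivative q * (P * S) := by
          rw [hPq]; ac_rfl
      _ = _ := by rw [hPS, hfh, mul_pow]; ac_rfl
  obtain ⟨B, hB⟩ := hdvd
  obtain ⟨E, hE⟩ := hH
  have hE' : h ^ (d + 1) * H.map φ = 1 + τ ^ (d + 1) * E.map φ := by
    have := congrArg (Polynomial.map φ) hE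
    simp only [Polynomial.map_sub, Polynomial.map_mul, Polynomial.map_pow, Polynomial.map_one,
      map_X, map_C] at this
    rw [← hh, ← hτ] at this
    linear_combination this
  have hder : derivative P = q + (X - C (x j)) * derivative q := by
    rw [hPq, derivative_mul]
    simp
  have key : derivative P * S * H.map φ =
      A + τ ^ (d + 1) * (A * E.map φ + B * H.map φ) := by
    rw [hder]
    linear_combination (H.map φ) * hqS + (H.map φ) * hB + A * hE'
  have hτX : taylor (φ (a j)) τ = X := by simp [hτ]
  -- The remainder is divisible by `τ ^ (d + 1)`, and only the term `m = 1` of `A` has degree `d -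
  -- 1` in `τ`.
  rw [key, map_add, taylor_mul, taylor_pow, hτX, coeff_add, coeff_X_pow_mul', if_neg (by omega),
    add_zero, hA, map_sum, finsetSum_coeff, Finset.sum_eq_single 1]
  · simp only [pow_one, taylor_mul, taylor_pow, hτX, taylor_C]
    simp
  · intro m hm hm1
    rw [taylor_mul, taylor_pow, taylor_pow, hτX, taylor_C, ← C_pow, coeff_C_mul, coeff_X_pow,
      if_neg, mul_zero]
    rw [Finset.mem_range] at hm
    omega
  · intro h1
    simp at h1
    omega

/-- By invertibility of the Vandermonde matrix, any functional on polynomials of degree below `N` is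
a combination of evaluations. This serves both the root formula and the truncation. -/
theorem exists_sum_mul_pow_eq {F : Type*} [Field F] {N : ℕ} {v : Fin N → F}
    (hv : Function.Injective v) (c : ℕ → F) :
    ∃ μ : Fin N → F, ∀ r < N, ∑ l, μ l * v l ^ r = c r := by
  have hdet : IsUnit (Matrix.vandermonde v).det :=
    isUnit_iff_ne_zero.2 (Matrix.det_vandermonde_ne_zero_iff.2 hv)
  refine ⟨Matrix.vecMul (fun r : Fin N => c r) (Matrix.vandermonde v)⁻¹, fun r hr => ?_⟩
  have h : Matrix.vecMul (Matrix.vecMul (fun r : Fin N => c r) (Matrix.vandermonde v)⁻¹)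
      (Matrix.vandermonde v) = fun r : Fin N => c r := by
    rw [Matrix.vecMul_vecMul, Matrix.nonsing_inv_mul _ hdet, Matrix.vecMul_one]
  have := congrFun h ⟨r, hr⟩
  simpa [Matrix.vecMul, dotProduct, Matrix.vandermonde_apply] using this

open Polynomial in
theorem Polynomial.exists_coeff_taylor_mul_eq_sum_eval {F : Type u} [Field F] {N : ℕ}
    {v : Fin N → F} (hv : Function.Injective v) (b : F) (H : F[X]) (e : ℕ) :
    ∃ μ : Fin N → F, ∀ (R : Type u) [CommRing R] [Algebra F R] (p : R[X]), p.natDegree < N →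
      (taylor (algebraMap F R b) (p * H.map (algebraMap F R))).coeff e =
        ∑ l, algebraMap F R (μ l) * p.eval (algebraMap F R (v l)) := by
  obtain ⟨μ, hμ⟩ := exists_sum_mul_pow_eq hv fun r => (taylor b (X ^ r * H)).coeff e
  refine ⟨μ, fun R _ _ p hp => ?_⟩
  set φ := algebraMap F R
  have h1 : p * H.map φ = ∑ r ∈ Finset.range N, C (p.coeff r) * (X ^ r * H).map φ := by
    conv_lhs => rw [p.as_sum_range' N hp]
    rw [Finset.sum_mul]
    refine Finset.sum_congr rfl fun r _ => ?_
    rw [← C_mul_X_pow_eq_monomial]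
    simp [mul_assoc]
  rw [h1, map_sum, finsetSum_coeff]
  have h2 : ∀ r ∈ Finset.range N,
      (taylor (φ b) (C (p.coeff r) * (X ^ r * H).map φ)).coeff e =
        ∑ l, φ (μ l) * (p.coeff r * φ (v l) ^ r) := by
    intro r hr
    rw [taylor_mul, taylor_C, coeff_C_mul, ← map_taylor, coeff_map, ← hμ r (Finset.mem_range.1 hr),
      map_sum, Finset.mul_sum]
    refine Finset.sum_congr rfl fun l _ => ?_
    rw [map_mul, map_pow]
    ring
  rw [Finset.sum_congr rfl h2, Finset.sum_comm]
  refine Finset.sum_congr rfl fun l _ => ?_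
  rw [← Finset.mul_sum, eval_eq_sum_range' hp]

open Polynomial in
/-- The `j`-th root of a monic polynomial that is a nilpotent perturbation of the split polynomial
with the distinct roots `a i` is a fixed linear combination of values of polynomial expressions in
the perturbed polynomial. -/
theorem Polynomial.exists_root_eq_sum_eval {F : Type u} [Field F] {n d : ℕ} (hd : 0 < d)
    {a : Fin n → F} (ha : Function.Injective a) {v : Fin (n * (d + 1) + 1) → F}
    (hv : Function.Injective v) (j : Fin n) :
    ∃ μ : Fin (n * (d + 1) + 1) → F, ∀ (R : Type u) [CommRing R] [Algebra F R] (I : Ideal R)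
      (x : Fin n → R), I ^ (d + 1) = ⊥ → (∀ i, x i - algebraMap F R (a i) ∈ I) →
      x j = algebraMap F R (a j) + ∑ l, algebraMap F R (μ l) *
        ((derivative (∏ i, (X - C (x i)))).eval (algebraMap F R (v l)) *
        ∑ m ∈ Finset.range (d + 1),
          (algebraMap F R ((∏ i, (X - C (a i))).eval (v l)) -
            (∏ i, (X - C (x i))).eval (algebraMap F R (v l))) ^ m *
          algebraMap F R ((∏ i, (X - C (a i))).eval (v l)) ^ (d - m)) := by
  have hcop : IsCoprime ((X - C (a j)) ^ (d + 1))
      ((∏ i ∈ Finset.univ.erase j, (X - C (a i))) ^ (d + 1)) := by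
    refine IsCoprime.pow (IsCoprime.prod_right fun i hi => ?_)
    exact isCoprime_X_sub_C_of_isUnit_sub
      (isUnit_iff_ne_zero.2 (sub_ne_zero.2 fun h => Finset.ne_of_mem_erase hi (ha h.symm)))
  obtain ⟨E, H, hEH⟩ := hcop
  obtain ⟨μ, hμ⟩ := exists_coeff_taylor_mul_eq_sum_eval hv (a j) H (d - 1)
  refine ⟨μ, fun R _ _ I x hI hx => ?_⟩
  have h1 := coeff_taylor_derivative_prod_X_sub_C ha hd hI hx j (H := H)
    ⟨-E, by linear_combination hEH⟩
  rw [hμ R] at h1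
  · rw [add_comm, ← sub_eq_iff_eq_add, ← h1]
    refine Finset.sum_congr rfl fun l _ => ?_
    rw [eval_mul, eval_finsetSum]
    simp only [eval_mul, eval_pow, eval_sub, eval_map_algebraMap, aeval_algebraMap_apply,
      coe_aeval_eq_eval]
  -- The derivative contributes degree at most `n` and the geometric sum at most `n * d`, hence `n *
  -- (d + 1) + 1` nodes.
  · have hP : ∀ (T : Type u) [CommRing T] (z : Fin n → T),
        (∏ i, (X - C (z i))).natDegree ≤ n := by
      intro T _ z
      refine (natDegree_prod_le _ _).trans ?_
      refine (Finset.sum_le_card_nsmul _ _ 1 fun i _ => natDegree_X_sub_C_le _).trans ?_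
      simp
    have hf : ((∏ i, (X - C (a i))).map (algebraMap F R)).natDegree ≤ n :=
      natDegree_map_le.trans (hP F a)
    refine Nat.lt_succ_of_le (natDegree_mul_le.trans ?_)
    rw [mul_add, mul_one, add_comm (n * d)]
    refine Nat.add_le_add ((natDegree_derivative_le _).trans ((Nat.sub_le _ _).trans (hP R x))) ?_
    refine natDegree_sum_le_of_forall_le _ _ fun m hm => ?_
    refine natDegree_mul_le.trans ?_
    have e1 := natDegree_pow_le_of_le m (natDegree_sub_le_of_le hf (hP R x))
    have e2 := natDegree_pow_le_of_le (d - m) hf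
    have e3 : m + (d - m) = d := by
      rw [Finset.mem_range] at hm
      omega
    rw [max_self] at e1
    calc _ ≤ m * n + (d - m) * n := Nat.add_le_add e1 e2
      _ = n * d := by rw [← add_mul, e3, mul_comm]

end RootFormula

/-! ### Inverting the elementary symmetric map modulo high degree. -/

section Inversion

/-- The kernels of the iterates stabilise, say at `n`. An element of `ker f` has the form `f ^ n y`,
so `y` lies in `ker (f ^ (n + 1)) = ker (f ^ n)`. -/
theorem RingHom.injective_of_surjective_endomorphism {R : Type*} [CommRing R] [IsNoetherianRing R]
    (f : R →+* R) (hf : Function.Surjective f) : Function.Injective f := by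
  have hmono : Monotone fun n => RingHom.ker (f ^ n) := monotone_nat_of_le_succ fun n x hx => by
    rw [RingHom.mem_ker] at hx ⊢
    rw [pow_succ', RingHom.mul_def, RingHom.comp_apply, hx, map_zero]
  obtain ⟨n, hn⟩ := monotone_stabilizes_iff_noetherian.2 ‹IsNoetherianRing R› ⟨_, hmono⟩
  refine (injective_iff_map_eq_zero f).2 fun x hx => ?_
  have hsurj : Function.Surjective (f ^ n : R →+* R) := by
    rw [RingHom.coe_pow]
    exact hf.iterate n
  obtain ⟨y, rfl⟩ := hsurj x
  have hy : y ∈ RingHom.ker (f ^ (n + 1)) := by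
    rwa [RingHom.mem_ker, pow_succ', RingHom.mul_def, RingHom.comp_apply]
  have h := hn (n + 1) n.le_succ
  simp only [OrderHom.coe_mk] at h
  rwa [← h, RingHom.mem_ker] at hy

/-- The elementary symmetric function of degree `r + 1` of the elements `a j`. -/
noncomputable def esymValue {F : Type*} [CommSemiring F] {n : ℕ} (a : Fin n → F) (r : Fin n) : F :=
  aeval a (esymm (Fin n) F (r + 1))

variable {F : Type u} [Field F] {k n d : ℕ}

/-- The polynomials `ψ j`, evaluated at the increments of the elementary symmetric functions,
recover any point that is congruent to `a` modulo an ideal with vanishing power `d + 1`. -/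
def InvertsEsym (d : ℕ) (a : Fin n → F) (ψ : Fin n → MvPolynomial (Fin n) F) : Prop :=
  ∀ (R : Type u) [CommRing R] [Algebra F R] (I : Ideal R) (x : Fin n → R), I ^ (d + 1) = ⊥ →
    (∀ j, x j - algebraMap F R (a j) ∈ I) → ∀ j,
    aeval (fun r => esymValue x r - algebraMap F R (esymValue a r)) (ψ j) = x j

theorem map_blockEsym_eq_esymValue {R : Type*} [CommSemiring R] [Algebra F R] {E : Type*}
    [FunLike E (MvPolynomial (Fin k × Fin n) F) R] [AlgHomClass E F (MvPolynomial (Fin k × Fin n) F) R]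
    (g : E) (i : Fin k) (r : Fin n) :
    g (blockEsym F n i ((r : ℕ) + 1)) = esymValue (fun j => g (X (i, j))) r := by
  simp only [blockEsym, esymValue, esymm, map_sum, map_prod, rename_X, aeval_X]

theorem map_esymValue {R S : Type*} [CommSemiring R] [CommSemiring S] (g : R →+* S)
    (x : Fin n → R) (r : Fin n) : g (esymValue x r) = esymValue (fun j => g (x j)) r := by
  simp only [esymValue, esymm, map_sum, map_prod, aeval_X]

/-- `α` descends to an endomorphism of the Noetherian ring `B`; `β` makes it surjective, hence it is
injective. -/
theorem mem_ker_of_map_mem_ker {X : Type*} [Finite X] {B : Type*} [CommRing B] [Algebra F B]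
    {π : MvPolynomial X F →ₐ[F] B} (hπ : Function.Surjective π)
    {α β : MvPolynomial X F →ₐ[F] MvPolynomial X F}
    (hα : ∀ p, π p = 0 → π (α p) = 0) (hαβ : ∀ x, π (α (β (MvPolynomial.X x))) = π (MvPolynomial.X x))
    {p : MvPolynomial X F} (hp : π (α p) = 0) : π p = 0 := by
  have : IsNoetherianRing B := isNoetherianRing_of_surjective _ _ π.toRingHom hπ
  let f : B →ₐ[F] B := Ideal.Quotient.liftₐ (RingHom.ker π) (π.comp α) hα |>.comp
    (Ideal.quotientKerAlgEquivOfSurjective hπ).symm.toAlgHom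
  have hf : ∀ p, f (π p) = π (α p) := by
    intro p
    have : (Ideal.quotientKerAlgEquivOfSurjective hπ).symm (π p) = Ideal.Quotient.mk _ p := by
      rw [AlgEquiv.symm_apply_eq]
      rfl
    change Ideal.Quotient.liftₐ (RingHom.ker π) (π.comp α) hα
      ((Ideal.quotientKerAlgEquivOfSurjective hπ).symm (π p)) = _
    rw [this]
    rfl
  have hsurj : Function.Surjective f := by
    intro y
    obtain ⟨q, rfl⟩ := hπ y
    have h : (π.comp α).comp β = π := by
      ext x
      exact hαβ x
    exact ⟨π (β q), (hf _).trans (DFunLike.congr_fun h q)⟩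
  have hinj := (f : B →+* B).injective_of_surjective_endomorphism hsurj
  refine (injective_iff_map_eq_zero (f : B →+* B)).1 hinj _ ?_
  exact (hf p).trans hp

/-- The increments of the elementary symmetric polynomials of the blocks at the point that has the
coordinates `a` in each block. -/
noncomputable def esymIncrement (k : ℕ) (a : Fin n → F) :
    MvPolynomial (Fin k × Fin n) F →ₐ[F] MvPolynomial (Fin k × Fin n) F :=
  bind₁ fun p => esymValue (fun j => X (p.1, j) + C (a j)) p.2 - C (esymValue a p.2)

theorem esymIncrement_mem_idealOfVars (a : Fin n → F) (p : Fin k × Fin n) :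
    esymIncrement k a (X p) ∈ idealOfVars (Fin k × Fin n) F := by
  have h0 : constantCoeff (esymIncrement k a (X p)) = 0 := by
    rw [esymIncrement, bind₁_X_right, map_sub, constantCoeff_C, map_esymValue]
    simp
  rw [← pow_one (idealOfVars (Fin k × Fin n) F), mem_pow_idealOfVars_iff']
  intro x hx
  rw [Nat.lt_one_iff] at hx
  rw [(Finsupp.degree_eq_zero_iff x).1 hx]
  exact h0

theorem esymIncrement_mem_pow {a : Fin n → F} {p : MvPolynomial (Fin k × Fin n) F} {e : ℕ}
    (hp : p ∈ idealOfVars (Fin k × Fin n) F ^ e) :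
    esymIncrement k a p ∈ idealOfVars (Fin k × Fin n) F ^ e := by
  have h : (idealOfVars (Fin k × Fin n) F).map (esymIncrement k a) ≤ idealOfVars _ F := by
    conv_lhs => rw [idealOfVars, Ideal.map_span]
    rw [Ideal.span_le]
    rintro _ ⟨_, ⟨p, rfl⟩, rfl⟩
    exact esymIncrement_mem_idealOfVars a p
  have h1 := Ideal.mem_map_of_mem (esymIncrement k a) hp
  rw [Ideal.map_pow] at h1
  exact Ideal.pow_right_mono h e h1

theorem esymIncrement_bind₁ (a : Fin n → F) (Q : MvPolynomial (Fin k × Fin n) F) :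
    esymIncrement k a (bind₁ (fun p => X p + C (esymValue a p.2)) Q) =
      bind₁ (fun p => X p + C (a p.2)) (compEsym Q) := by
  have : (esymIncrement k a).comp (bind₁ (fun p => X p + C (esymValue a p.2))) =
      (bind₁ (fun p => X p + C (a p.2))).comp
        (bind₁ fun p : Fin k × Fin n => blockEsym F n p.1 ((p.2 : ℕ) + 1)) := by
    ext1 p
    rw [AlgHom.comp_apply, AlgHom.comp_apply, bind₁_X_right, bind₁_X_right,
      map_blockEsym_eq_esymValue, map_add, esymIncrement, bind₁_C_right, bind₁_X_right]
    simp
  exact DFunLike.congr_fun this Q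

theorem InvertsEsym.map_esymIncrement {a : Fin n → F} {ψ : Fin n → MvPolynomial (Fin n) F}
    (hψ : InvertsEsym d a ψ) {B : Type u} [CommRing B] [Algebra F B]
    (π : MvPolynomial (Fin k × Fin n) F →ₐ[F] B)
    (hI : (idealOfVars (Fin k × Fin n) F).map π ^ (d + 1) = ⊥) (i : Fin k) (j : Fin n) :
    π (esymIncrement k a (rename (fun r => (i, r)) (ψ j))) = π (X (i, j) + C (a j)) := by
  rw [← hψ B _ (fun j => π (X (i, j) + C (a j))) hI (fun j => by
    rw [map_add, ← algebraMap_eq, AlgHom.commutes, add_sub_cancel_right]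
    exact Ideal.mem_map_of_mem _ (Ideal.subset_span ⟨_, rfl⟩)) j]
  have : (π.comp (esymIncrement k a)).comp (rename fun r => (i, r)) =
      aeval (fun r => esymValue (fun j => π (X (i, j) + C (a j))) r -
        algebraMap F B (esymValue a r)) := by
    ext r
    rw [AlgHom.comp_apply, AlgHom.comp_apply, rename_X, esymIncrement, bind₁_X_right, aeval_X,
      map_sub, ← algebraMap_eq, AlgHom.commutes]
    congr 1
    exact map_esymValue π.toRingHom _ _
  exact DFunLike.congr_fun this (ψ j)

/-- Substituting the increments turns both terms into `compEsym Q` at `x + a`, modulo the power of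
the ideal. That substitution is injective on the quotient, so it can be cancelled. -/
theorem InvertsEsym.sub_mem_pow_idealOfVars {a : Fin n → F} {ψ : Fin n → MvPolynomial (Fin n) F}
    (hψ : InvertsEsym d a ψ) (Q : MvPolynomial (Fin k × Fin n) F) :
    bind₁ (fun p : Fin k × Fin n => rename (fun r => (p.1, r)) (ψ p.2)) (compEsym Q) -
      bind₁ (fun p : Fin k × Fin n => X p + C (esymValue a p.2)) Q ∈
        idealOfVars (Fin k × Fin n) F ^ (d + 1) := by
  have hker : ∀ p, Ideal.Quotient.mkₐ F (idealOfVars (Fin k × Fin n) F ^ (d + 1)) p = 0 ↔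
      p ∈ idealOfVars (Fin k × Fin n) F ^ (d + 1) := fun p => Ideal.Quotient.eq_zero_iff_mem
  have hI : (idealOfVars (Fin k × Fin n) F).map
      (Ideal.Quotient.mkₐ F (idealOfVars (Fin k × Fin n) F ^ (d + 1))) ^ (d + 1) = ⊥ := by
    rw [← Ideal.map_pow]
    exact Ideal.map_quotient_self _
  have hsurj := Ideal.Quotient.mkₐ_surjective F (idealOfVars (Fin k × Fin n) F ^ (d + 1))
  generalize Ideal.Quotient.mkₐ F (idealOfVars (Fin k × Fin n) F ^ (d + 1)) = π at hker hI hsurj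
  have hψπ := hψ.map_esymIncrement π hI
  rw [← hker]
  refine mem_ker_of_map_mem_ker hsurj (α := esymIncrement k a)
    (β := bind₁ fun p => rename (fun r => (p.1, r)) (ψ p.2) - C (a p.2)) (fun p hp => ?_)
    (fun p => ?_) ?_
  · rw [hker] at hp ⊢
    exact esymIncrement_mem_pow hp
  · rw [bind₁_X_right, map_sub, map_sub, hψπ, esymIncrement, bind₁_C_right, ← map_sub,
      add_sub_cancel_right]
  · rw [map_sub, map_sub, esymIncrement_bind₁, sub_eq_zero]
    have : (π.comp (esymIncrement k a)).comp
        (bind₁ fun p : Fin k × Fin n => rename (fun r => (p.1, r)) (ψ p.2)) =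
        π.comp (bind₁ fun p => X p + C (a p.2)) := by
      ext p
      rw [AlgHom.comp_apply, AlgHom.comp_apply, AlgHom.comp_apply, bind₁_X_right, bind₁_X_right]
      exact hψπ p.1 p.2
    exact DFunLike.congr_fun this (compEsym Q)

theorem coeff_bind₁_C_mul_X {F X : Type*} [CommSemiring F] (t : F) (G : MvPolynomial X F)
    (m : X →₀ ℕ) :
    coeff m (bind₁ (fun p => C t * MvPolynomial.X p) G) = t ^ m.degree * coeff m G := by
  classical
  induction G using MvPolynomial.induction_on' with
  | monomial u c =>
    rw [bind₁_monomial]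
    have : ∏ i ∈ u.support, (C t * MvPolynomial.X i : MvPolynomial X F) ^ u i =
        C (t ^ u.degree) * monomial u 1 := by
      simp only [mul_pow, Finset.prod_mul_distrib]
      rw [monomial_eq, C_1, one_mul, Finsupp.prod, Finset.prod_pow_eq_pow_sum, ← C_pow,
        Finsupp.degree_apply]
    rw [this, ← mul_assoc, ← C_mul, C_mul_monomial, coeff_monomial, coeff_monomial]
    split_ifs with h
    · rw [h]; ring
    · simp
  | add p q hp hq => rw [map_add, coeff_add, coeff_add, hp, hq, mul_add]

theorem exists_eq_sum_bind₁_C_mul_X {X : Type*} {G H : MvPolynomial X F} {D : ℕ}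
    (hGH : G - H ∈ idealOfVars X F ^ (d + 1)) (hH : H.totalDegree ≤ d) (hG : G.totalDegree ≤ D)
    {t : Fin (D + 1) → F} (ht : Function.Injective t) :
    ∃ c : Fin (D + 1) → F,
      H = ∑ l, C (c l) * bind₁ (fun p => C (t l) * MvPolynomial.X p) G := by
  -- These weights keep the degrees up to `d` and kill those from `d + 1` to `D`.
  obtain ⟨c, hc⟩ := exists_sum_mul_pow_eq ht fun r => if r ≤ d then 1 else 0
  refine ⟨c, MvPolynomial.ext _ _ fun m => ?_⟩
  rw [mem_pow_idealOfVars_iff'] at hGH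
  simp only [coeff_sum, coeff_C_mul, coeff_bind₁_C_mul_X, ← mul_assoc]
  rw [← Finset.sum_mul]
  have hdeg : ∀ {p : MvPolynomial X F}, p.totalDegree < m.degree → coeff m p = 0 :=
    fun h => coeff_eq_zero_of_totalDegree_lt h
  rcases le_or_gt m.degree D with h1 | h1
  · rw [hc _ (Nat.lt_succ_of_le h1)]
    split_ifs with h2
    · have := hGH m (Nat.lt_succ_of_le h2)
      rw [coeff_sub, sub_eq_zero] at this
      rw [one_mul, this]
    · rw [zero_mul, hdeg (hH.trans_lt (not_le.1 h2))]
  · rw [hdeg (hG.trans_lt h1), mul_zero]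
    by_cases h2 : m.degree ≤ d
    · have := hGH m (Nat.lt_succ_of_le h2)
      rw [coeff_sub, hdeg (hG.trans_lt h1), zero_sub, neg_eq_zero] at this
      exact this
    · exact hdeg (hH.trans_lt (not_le.1 h2))

theorem totalDegree_bind₁_le {F X Y : Type*} [CommSemiring F] {θ : X → MvPolynomial Y F} {e : ℕ}
    (hθ : ∀ x, (θ x).totalDegree ≤ e) (P : MvPolynomial X F) :
    (bind₁ θ P).totalDegree ≤ P.totalDegree * e := by
  conv_lhs => rw [P.as_sum, map_sum]
  refine totalDegree_finsetSum_le fun m hm => ?_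
  rw [bind₁_monomial]
  refine (totalDegree_mul _ _).trans ?_
  rw [totalDegree_C, zero_add]
  refine (totalDegree_finsetProd _ _).trans ?_
  calc ∑ x ∈ m.support, (θ x ^ m x).totalDegree ≤ ∑ x ∈ m.support, m x * e :=
        Finset.sum_le_sum fun x _ => (totalDegree_pow _ _).trans (Nat.mul_le_mul_left _ (hθ x))
    _ = m.degree * e := by rw [← Finset.sum_mul, Finsupp.degree_apply]
    _ ≤ _ := Nat.mul_le_mul_right _ (le_totalDegree hm)

theorem InvertsEsym.exists_eq_sum_bind₁ {a : Fin n → F} {ψ : Fin n → MvPolynomial (Fin n) F}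
    (hψ : InvertsEsym d a ψ) {e D : ℕ} (he : ∀ j, (ψ j).totalDegree ≤ e)
    {t : Fin (D + 1) → F} (ht : Function.Injective t) {Q : MvPolynomial (Fin k × Fin n) F}
    (hQ : (compEsym Q).totalDegree ≤ d) (hD : d * e ≤ D) :
    ∃ c : Fin (D + 1) → F, Q = ∑ l, C (c l) * bind₁ (fun p : Fin k × Fin n =>
      bind₁ (fun r : Fin n => C (t l) * (X (p.1, r) + C (-esymValue a r))) (ψ p.2)) (compEsym Q) := by
  have h1 := hψ.sub_mem_pow_idealOfVars Q
  obtain ⟨c, hc⟩ := exists_eq_sum_bind₁_C_mul_X (D := D) h1 (by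
      refine (totalDegree_bind₁_le (e := 1) (fun p => ?_) Q).trans ?_
      · refine (totalDegree_add _ _).trans ?_
        simp
      · rw [mul_one]
        exact (totalDegree_le_totalDegree_compEsym Q).trans hQ) (by
      refine (totalDegree_bind₁_le (e := e) (fun p => ?_) _).trans
        ((Nat.mul_le_mul_right _ hQ).trans hD)
      exact (totalDegree_rename_le _ _).trans (he _)) ht
  refine ⟨c, ?_⟩
  -- Interpolation gives the shifted `Q`; this translation undoes the shift.
  have h2 := congrArg (bind₁ fun p : Fin k × Fin n => X p + C (-esymValue a p.2)) hc
  have h3 : bind₁ (fun p : Fin k × Fin n => X p + C (-esymValue a p.2))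
      (bind₁ (fun p : Fin k × Fin n => X p + C (esymValue a p.2)) Q) = Q := by
    rw [bind₁_bind₁]
    convert aeval_X_left_apply Q using 2
    simp
  rw [h3, map_sum] at h2
  refine h2.trans (Finset.sum_congr rfl fun l _ => ?_)
  rw [map_mul, bind₁_C_right, bind₁_bind₁, bind₁_bind₁]
  congr 3
  funext p
  rw [bind₁_rename]
  congr 2
  funext r
  simp

end Inversion

/-! ### The truncated roots as small circuits of constant depth. -/

section RootPolynomials

open Polynomial in
theorem Polynomial.prod_X_sub_C_eq_sum_esymValue {R : Type*} [CommRing R] {n : ℕ} (x : Fin n → R) :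
    ∏ i, (X - C (x i)) =
      X ^ n - ∑ r : Fin n, C ((-1) ^ (r : ℕ) * esymValue x r) * X ^ (n - ((r : ℕ) + 1)) := by
  have h := Multiset.prod_X_sub_X_eq_sum_esymm (Finset.univ.val.map x)
  rw [Multiset.map_map, Multiset.card_map, Finset.card_val, Finset.card_univ, Fintype.card_fin,
    Finset.sum_range_succ', Finset.sum_range] at h
  have h0 : (∏ i, (X - C (x i))) =
      (Multiset.map ((fun t => X - C t) ∘ x) Finset.univ.val).prod := rfl
  rw [h0, h, add_comm, sub_eq_add_neg, ← Finset.sum_neg_distrib]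
  congr 1
  · simp [Multiset.esymm]
  · refine Finset.sum_congr rfl fun r _ => ?_
    rw [esymValue, aeval_esymm_eq_multiset_esymm, C_mul, pow_succ]
    simp
    ring

-- The leading terms cancel, so the difference is linear in the increments; hence its values and
-- those of its derivative are linear forms.
open Polynomial in
theorem Polynomial.map_prod_X_sub_C_sub {F R : Type*} [CommRing F] [CommRing R] [Algebra F R] {n : ℕ}
    (a : Fin n → F) (x : Fin n → R) :
    (∏ i, (X - C (a i))).map (algebraMap F R) - ∏ i, (X - C (x i)) =
      ∑ r : Fin n, C ((-1) ^ (r : ℕ) * (esymValue x r - algebraMap F R (esymValue a r))) *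
        X ^ (n - ((r : ℕ) + 1)) := by
  rw [prod_X_sub_C_eq_sum_esymValue, prod_X_sub_C_eq_sum_esymValue, Polynomial.map_sub,
    Polynomial.map_sum, Polynomial.map_pow, map_X, sub_sub_sub_cancel_left,
    ← Finset.sum_sub_distrib]
  refine Finset.sum_congr rfl fun r _ => ?_
  simp only [Polynomial.map_mul, Polynomial.map_pow, map_X, map_C, map_mul, map_pow, map_neg,
    map_one, map_sub, Polynomial.map_neg, Polynomial.map_one]
  ring

variable {F : Type u} [Field F] {n N : ℕ}

/-- The linear form with the coefficients `b`. -/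
noncomputable def linearForm (b : Fin n → F) : MvPolynomial (Fin n) F := ∑ r, C (b r) * X r

/-- The value at `t` of the increment of the polynomial with given roots, as a linear form in the
increments of the elementary symmetric functions of the roots. -/
noncomputable def incrementForm (n : ℕ) (t : F) : MvPolynomial (Fin n) F :=
  linearForm fun r => (-1) ^ (r : ℕ) * t ^ (n - ((r : ℕ) + 1))

/-- The value at `t` of the derivative of the increment of the polynomial with given roots, as a
linear form in the increments of the elementary symmetric functions of the roots. -/
noncomputable def derivIncrementForm (n : ℕ) (t : F) : MvPolynomial (Fin n) F :=
  linearForm fun r => (-1) ^ (r : ℕ) * 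
    (Polynomial.derivative (Polynomial.X ^ (n - ((r : ℕ) + 1)))).eval t

/-- The candidate for the `j`-th root as a polynomial in the increments of the elementary symmetric
functions. -/
noncomputable def rootPoly (d : ℕ) (a : Fin n → F) (v μ : Fin N → F) (j : Fin n) :
    MvPolynomial (Fin n) F :=
  C (a j) + ∑ l, C (μ l) *
    ((C ((Polynomial.derivative (∏ i, (Polynomial.X - Polynomial.C (a i)))).eval (v l)) +
        C (-1) * derivIncrementForm n (v l)) *
      ∑ m ∈ Finset.range (d + 1), incrementForm n (v l) ^ m *
        C ((∏ i, (Polynomial.X - Polynomial.C (a i))).eval (v l) ^ (d - m)))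

section

variable {R : Type*} [CommRing R] [Algebra F R] (a : Fin n → F) (x : Fin n → R) (t : F)

theorem aeval_linearForm (b : Fin n → F) (w : Fin n → R) :
    aeval w (linearForm b) = ∑ r, algebraMap F R (b r) * w r := by
  simp [linearForm]

open Polynomial in
theorem Polynomial.aeval_incrementForm :
    MvPolynomial.aeval (fun r => esymValue x r - algebraMap F R (esymValue a r)) (incrementForm n t) =
      algebraMap F R ((∏ i, (X - C (a i))).eval t) -
        (∏ i, (X - C (x i))).eval (algebraMap F R t) := by
  have h := congrArg (Polynomial.eval (algebraMap F R t)) (map_prod_X_sub_C_sub a x)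
  rw [eval_sub, eval_map_algebraMap, aeval_algebraMap_apply, coe_aeval_eq_eval] at h
  rw [h, incrementForm, aeval_linearForm, eval_finsetSum]
  refine Finset.sum_congr rfl fun r _ => ?_
  rw [eval_C_mul, eval_X_pow]
  simp only [map_mul, map_pow, map_neg, map_one]
  ring

open Polynomial in
theorem Polynomial.aeval_derivIncrementForm :
    MvPolynomial.aeval (fun r => esymValue x r - algebraMap F R (esymValue a r))
        (derivIncrementForm n t) =
      algebraMap F R ((derivative (∏ i, (X - C (a i)))).eval t) -
        (derivative (∏ i, (X - C (x i)))).eval (algebraMap F R t) := by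
  have h := congrArg (fun p => Polynomial.eval (algebraMap F R t) (derivative p))
    (map_prod_X_sub_C_sub a x)
  simp only [derivative_sub, derivative_map, eval_sub, eval_map_algebraMap, aeval_algebraMap_apply,
    coe_aeval_eq_eval, derivative_sum, eval_finsetSum] at h
  rw [h, derivIncrementForm, aeval_linearForm]
  refine Finset.sum_congr rfl fun r _ => ?_
  rw [derivative_C_mul, eval_C_mul, derivative_X_pow, derivative_X_pow, eval_C_mul, eval_C_mul,
    eval_X_pow, eval_X_pow]
  simp only [map_mul, map_pow, map_neg, map_one, map_natCast]
  ring

end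

theorem exists_invertsEsym_rootPoly {d : ℕ} (hd : 0 < d) {a : Fin n → F}
    (ha : Function.Injective a) {v : Fin (n * (d + 1) + 1) → F} (hv : Function.Injective v) :
    ∃ μ : Fin n → Fin (n * (d + 1) + 1) → F,
      InvertsEsym d a fun j => rootPoly d a v (μ j) j := by
  choose μ hμ using Polynomial.exists_root_eq_sum_eval hd ha hv
  refine ⟨μ, fun R _ _ I x hI hx j => ?_⟩
  conv_rhs => rw [hμ j R I x hI hx]
  simp only [rootPoly, map_add, map_sum, map_mul, map_pow, Polynomial.aeval_incrementForm,
    Polynomial.aeval_derivIncrementForm, ← algebraMap_eq, AlgHom.commutes, map_neg, map_one]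
  congr 1
  refine Finset.sum_congr rfl fun l _ => ?_
  congr 2
  ring

theorem totalDegree_linearForm_le (b : Fin n → F) : (linearForm b).totalDegree ≤ 1 :=
  totalDegree_finsetSum_le fun r _ => (totalDegree_mul _ _).trans (by simp)

theorem totalDegree_rootPoly_le (d : ℕ) (a : Fin n → F) (v μ : Fin N → F) (j : Fin n) :
    (rootPoly d a v μ j).totalDegree ≤ d + 1 := by
  refine (totalDegree_add _ _).trans (max_le (by simp) ?_)
  refine totalDegree_finsetSum_le fun l _ => (totalDegree_mul _ _).trans ?_
  rw [totalDegree_C, zero_add, add_comm d]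
  refine (totalDegree_mul _ _).trans (Nat.add_le_add ?_ ?_)
  · refine (totalDegree_add _ _).trans (max_le (by simp) ?_)
    refine (totalDegree_mul _ _).trans ?_
    rw [totalDegree_C, zero_add]
    exact totalDegree_linearForm_le _
  · refine totalDegree_finsetSum_le fun m hm => (totalDegree_mul _ _).trans ?_
    rw [totalDegree_C, add_zero]
    refine (totalDegree_pow _ _).trans ?_
    calc _ ≤ m * 1 := Nat.mul_le_mul_left _ (totalDegree_linearForm_le _)
      _ ≤ d := by rw [Finset.mem_range] at hm; omega

theorem isCheap_linearForm (b : Fin n → F) : IsCheap (linearForm b) (n * 6 + 1) 2 := by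
  have := IsCheap.finset_sum (Finset.univ : Finset (Fin n)) (f := fun r => C (b r) * X r)
    (c := 5) (δ := 1) (fun r _ => (IsCheap.const _).mul (IsCheap.var _))
  rw [Finset.card_univ, Fintype.card_fin] at this
  exact this

section

variable {M d : ℕ}

theorem isCheap_linearForm_pow (hn : n ≤ M) {m : ℕ} (hm : m ≤ M) (hM : 0 < M) (b : Fin n → F) :
    IsCheap (linearForm b ^ m) (9 * M ^ 2) 3 := by
  refine ((isCheap_linearForm b).pow m).mono ?_ le_rfl
  calc m * (n * 6 + 1 + 1) + 1 ≤ M * (M * 6 + M + M) + M * M := by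
        refine Nat.add_le_add (Nat.mul_le_mul hm ?_) (Nat.mul_pos hM hM)
        omega
    _ = 9 * M ^ 2 := by ring

theorem isCheap_sum_linearForm_pow (hn : n ≤ M) (hd : d ≤ M) (hM : 0 < M) (b : Fin n → F)
    (z : ℕ → F) :
    IsCheap (∑ m ∈ Finset.range (d + 1), linearForm b ^ m * C (z m)) (50 * M ^ 3) 5 := by
  have h2 : 1 ≤ M ^ 2 := Nat.one_le_pow _ _ hM
  have h3 : 1 ≤ M ^ 3 := Nat.one_le_pow _ _ hM
  refine (IsCheap.finset_sum (c := 21 * M ^ 2) (δ := 4) (Finset.range (d + 1))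
    fun m hm => ?_).mono ?_ le_rfl
  · rw [Finset.mem_range] at hm
    exact ((isCheap_linearForm_pow hn (by omega) hM b).mul
      ((IsCheap.const _).mono (by omega) (Nat.zero_le _))).mono (by omega) le_rfl
  · rw [Finset.card_range]
    calc (d + 1) * (21 * M ^ 2 + 1) + 1 ≤ (2 * M) * (22 * M ^ 2) + M ^ 3 :=
          Nat.add_le_add (Nat.mul_le_mul (by omega) (by omega)) h3
      _ = 45 * M ^ 3 := by ring
      _ ≤ 50 * M ^ 3 := Nat.mul_le_mul_right _ (by norm_num)

theorem isCheap_C_add_linearForm (hn : n ≤ M) (hM : 0 < M) (b : Fin n → F) (y z : F) :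
    IsCheap (C y + C z * linearForm b) (50 * M ^ 3) 5 := by
  have h1 : IsCheap (C z * linearForm b) (17 * M) 3 :=
    (((IsCheap.const z).mono (by omega) (by omega)).mul (isCheap_linearForm b)).mono
      (by omega) le_rfl
  refine (((IsCheap.const y).mono (by omega) (by omega)).add h1).mono ?_ (by omega)
  have h3 : M ≤ M ^ 3 := Nat.le_self_pow (by norm_num) M
  omega

/-- Depth 5 for each factor, then one level each for their product, the weight, the sum over the
nodes and the addition of `a j`. -/
theorem isCheap_rootPoly (a : Fin n → F) (v μ : Fin N → F) (j : Fin n) (hn : n ≤ M)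
    (hd : d ≤ M) (hN : N ≤ 3 * M ^ 2) (hM : 0 < M) :
    IsCheap (rootPoly d a v μ j) (1500 * M ^ 5) 9 := by
  have h3 : 1 ≤ M ^ 3 := Nat.one_le_pow _ _ hM
  have h5 : 1 ≤ M ^ 5 := Nat.one_le_pow _ _ hM
  have e1 : ∀ (b b' : Fin n → F) (x y z : F) (w : ℕ → F),
      IsCheap (C x * ((C y + C z * linearForm b) *
        ∑ m ∈ Finset.range (d + 1), linearForm b' ^ m * C (w m))) (220 * M ^ 3) 7 := by
    intro b b' x y z w
    have e2 := ((isCheap_C_add_linearForm hn hM b y z).mul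
      (isCheap_sum_linearForm_pow hn hd hM b' w)).mono (c' := 105 * M ^ 3) (by omega) le_rfl
    exact (((IsCheap.const x).mono (by omega) (by omega)).mul e2).mono (by omega) le_rfl
  have e3 : ∀ (b b' : Fin N → Fin n → F) (x y z : Fin N → F) (w : Fin N → ℕ → F),
      IsCheap (∑ l, C (x l) * ((C (y l) + C (z l) * linearForm (b l)) *
        ∑ m ∈ Finset.range (d + 1), linearForm (b' l) ^ m * C (w l m))) (700 * M ^ 5) 8 := by
    intro b b' x y z w
    refine (IsCheap.finset_sum Finset.univ fun l _ => e1 _ _ _ _ _ _).mono ?_ le_rfl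
    rw [Finset.card_univ, Fintype.card_fin]
    calc N * (220 * M ^ 3 + 1) + 1 ≤ (3 * M ^ 2) * (221 * M ^ 3) + M ^ 5 :=
          Nat.add_le_add (Nat.mul_le_mul hN (by omega)) h5
      _ = 664 * M ^ 5 := by ring
      _ ≤ 700 * M ^ 5 := Nat.mul_le_mul_right _ (by norm_num)
  unfold rootPoly incrementForm derivIncrementForm
  exact (((IsCheap.const (a j)).mono (by omega) (by omega)).add (e3 _ _ _ _ _ _)).mono
    (by omega) le_rfl

end

end RootPolynomials

/-! ### Assembling the circuit for `Q`. -/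

section MultiSymmetricCircuits

theorem exists_fin_injective_of_le_card {F : Type*} {m : ℕ} (h : (m : ℕ∞) ≤ ENat.card F) :
    ∃ f : Fin m → F, Function.Injective f := by
  cases finite_or_infinite F with
  | inl hF =>
    have := Fintype.ofFinite F
    rw [ENat.card_eq_coe_fintype_card, Nat.cast_le] at h
    obtain ⟨f⟩ := Function.Embedding.nonempty_of_card_le (α := Fin m) (β := F) (by simpa using h)
    exact ⟨f, f.injective⟩
  | inr hF =>
    exact ⟨fun i => Infinite.natEmbedding F i,
      (Infinite.natEmbedding F).injective.comp Fin.val_injective⟩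

theorem AlgebraicCircuit.size_pos {F X : Type*} (A : AlgebraicCircuit F X) : 0 < A.size := by
  obtain ⟨m, G, i⟩ := A
  cases G with
  | nil => exact i.elim0
  | snoc G g =>
    simp only [AlgebraicCircuit.size, GateList.size]
    omega

theorem compEsym_one {F : Type*} [CommSemiring F] {k : ℕ} (Q : MvPolynomial (Fin k × Fin 1) F) :
    compEsym Q = Q := by
  have : (fun p : Fin k × Fin 1 => blockEsym F 1 p.1 ((p.2 : ℕ) + 1)) = X := by
    funext ⟨i, j⟩
    rw [Subsingleton.elim j 0]
    simp [blockEsym]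
  rw [compEsym, this, bind₁_X_left, AlgHom.id_apply]

/-- The 13 extra levels are 2 for the scaled and shifted inputs, 9 for the roots, 1 for the
interpolation weight and 1 for the outer sum. That sum has `d * (d + 1) + 1` terms because the roots
have degree at most `d + 1` and `compEsym Q` at most `d`. -/
theorem isCheap_of_compEsym {F : Type u} [Field F] {k n d M : ℕ} (hd : 0 < d) (hnM : n ≤ M)
    (hdM : d ≤ M) {Q : MvPolynomial (Fin k × Fin n) F} (hQ : (compEsym Q).totalDegree ≤ d)
    (hn : (n : ℕ∞) ≤ ENat.card F) (hn' : ((n * (d + 1) + 1 : ℕ) : ℕ∞) ≤ ENat.card F)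
    (hd' : ((d * (d + 1) + 1 : ℕ) : ℕ∞) ≤ ENat.card F)
    {A : AlgebraicCircuit F (Fin k × Fin n)} (hA : A.Computes (compEsym Q)) (hAM : A.size ≤ M) :
    IsCheap Q (130000 * M ^ 8) (A.depth + 13) := by
  have hM : 0 < M := hd.trans_le hdM
  obtain ⟨a, ha⟩ := exists_fin_injective_of_le_card hn
  obtain ⟨v, hv⟩ := exists_fin_injective_of_le_card hn'
  obtain ⟨t, ht⟩ := exists_fin_injective_of_le_card hd'
  obtain ⟨μ, hμ⟩ := exists_invertsEsym_rootPoly hd ha hv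
  obtain ⟨c, hc⟩ := hμ.exists_eq_sum_bind₁ (fun j => totalDegree_rootPoly_le d a v (μ j) j) ht hQ
    le_rfl
  have h5 : 1 ≤ M ^ 5 := Nat.one_le_pow _ _ hM
  have h6 : 1 ≤ M ^ 6 := Nat.one_le_pow _ _ hM
  have h8 : 1 ≤ M ^ 8 := Nat.one_le_pow _ _ hM
  have hMM : M ≤ M ^ 2 := Nat.le_self_pow (by norm_num) M
  have hM2 : 1 ≤ M ^ 2 := Nat.one_le_pow _ _ hM
  have hroot : ∀ (b : F) (p : Fin k × Fin n),
      IsCheap (bind₁ (fun r : Fin n => C b * (X (p.1, r) + C (-esymValue a r)))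
        (rootPoly d a v (μ p.2) p.2)) (21000 * M ^ 5) 11 := by
    intro b p
    obtain ⟨B, hB, hBs, hBd⟩ := (isCheap_rootPoly a v (μ p.2) p.2 hnM hdM (by
      calc n * (d + 1) + 1 ≤ M * (M + 1) + 1 := by gcongr
        _ = M ^ 2 + M + 1 := by ring
        _ ≤ 3 * M ^ 2 := by omega) hM).exists_circuit
    have hlin : ∀ r : Fin n,
        IsCheap (C b * (X (p.1, r) + C (-esymValue a r)) : MvPolynomial (Fin k × Fin n) F) 13 2 :=
      fun r => ((IsCheap.const _).mono (by norm_num) (by norm_num)).mul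
        ((IsCheap.var _).add (IsCheap.const _))
    refine (IsCheap.bind₁ hlin hB).mono ?_ (by omega)
    omega
  have hterm : ∀ l ∈ (Finset.univ : Finset (Fin (d * (d + 1) + 1))),
      IsCheap (C (c l) * bind₁ (fun p : Fin k × Fin n =>
        bind₁ (fun r : Fin n => C (t l) * (X (p.1, r) + C (-esymValue a r)))
          (rootPoly d a v (μ p.2) p.2)) (compEsym Q)) (42005 * M ^ 6) (A.depth + 12) := by
    intro l _
    have h := (IsCheap.bind₁ (hroot (t l)) hA).mono (c' := 21001 * M ^ 6) (by
      calc A.size * (21000 * M ^ 5 + 1) ≤ M * (21001 * M ^ 5) :=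
            Nat.mul_le_mul hAM (by omega)
        _ = 21001 * M ^ 6 := by ring) le_rfl
    exact (((IsCheap.const (c l)).mono (by omega) (by omega)).mul h).mono (by omega) le_rfl
  rw [hc]
  refine (IsCheap.finset_sum _ hterm).mono ?_ le_rfl
  rw [Finset.card_univ, Fintype.card_fin]
  calc (d * (d + 1) + 1) * (42005 * M ^ 6 + 1) + 1 ≤ (3 * M ^ 2) * (42006 * M ^ 6) + M ^ 8 := by
        refine Nat.add_le_add (Nat.mul_le_mul ?_ (by omega)) h8
        calc d * (d + 1) + 1 ≤ M * (M + 1) + 1 := by gcongr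
          _ = M ^ 2 + M + 1 := by ring
          _ ≤ 3 * M ^ 2 := by omega
    _ = 126019 * M ^ 8 := by ring
    _ ≤ 130000 * M ^ 8 := Nat.mul_le_mul_right _ (by norm_num)

end MultiSymmetricCircuits

theorem mainTheorem4 :
    ∃ c K e : ℕ, 0 < c ∧
      ∀ (F : Type*) [Field F] (k n d s Δ : ℕ) (P : MvPolynomial (Fin k × Fin n) F)
        (C : AlgebraicCircuit F (Fin k × Fin n)),
        (((n * d * s) ^ c : ℕ) : ℕ∞) ≤ ENat.card F →
        IsMultiSymmetric P →
        P.totalDegree = d →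
        C.Computes P → C.size = s → C.depth = Δ →
        (∃! Q : MvPolynomial (Fin k × Fin n) F, P = compEsym Q) ∧
        ∀ Q : MvPolynomial (Fin k × Fin n) F, P = compEsym Q →
          Q.totalDegree ≤ d ∧
          ∃ C' : AlgebraicCircuit F (Fin k × Fin n),
            C'.Computes Q ∧ C'.size ≤ K * (s + d + n) ^ K ∧ C'.depth ≤ Δ + e := by
  -- One constant serves as factor and as exponent: it dominates both 130000 and 8, and the base `s
  -- + d + n` is positive.
  obtain ⟨K, hK⟩ : ∃ K : ℕ, 130000 ≤ K := ⟨_, le_rfl⟩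
  refine ⟨3, K, 13, by norm_num, ?_⟩
  intro F _ k n d s Δ P C hF hP hd hC hs hΔ
  refine ⟨?_, ?_⟩
  · obtain ⟨Q, hQ⟩ := hP.exists_compEsym
    exact ⟨Q, hQ, fun Q' hQ' => compEsym_injective k n F (hQ'.symm.trans hQ)⟩
  rintro Q rfl
  have hQd : Q.totalDegree ≤ d := hd ▸ totalDegree_le_totalDegree_compEsym Q
  refine ⟨hQd, ?_⟩
  have hspos : 0 < s := hs ▸ C.size_pos
  have hM : 0 < s + d + n := by omega
  have hbound : ∀ x j : ℕ, x ≤ 130000 * (s + d + n) ^ j → j ≤ 130000 →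
      x ≤ K * (s + d + n) ^ K := fun x j hx hj =>
    hx.trans (Nat.mul_le_mul hK (Nat.pow_le_pow_right hM (hj.trans hK)))
  have hconst : ∀ b : F, Q = MvPolynomial.C b → ∃ C' : AlgebraicCircuit F (Fin k × Fin n),
      C'.Computes Q ∧ C'.size ≤ K * (s + d + n) ^ K ∧ C'.depth ≤ Δ + 13 := by
    rintro b rfl
    obtain ⟨C', h1, h2, h3⟩ := (IsCheap.const (X := Fin k × Fin n) b).exists_circuit
    exact ⟨C', h1, hbound _ 0 (h2.trans (by norm_num)) (Nat.zero_le _), by omega⟩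
  rcases Nat.eq_zero_or_pos d with hd0 | hdpos
  · exact hconst _ (totalDegree_eq_zero_iff_eq_C.1 (by omega))
  rcases Nat.eq_zero_or_pos n with rfl | hnpos
  · exact hconst _ (eq_C_of_isEmpty Q)
  -- For `n = 1` the product `n * d * s` may be 1 and then says nothing about the size of `F`, but
  -- there `Q = P`.
  rcases Nat.eq_or_lt_of_le hnpos with rfl | hn2
  · refine ⟨C, hC.trans (compEsym_one Q), hbound _ 1 ?_ (by norm_num), by omega⟩
    rw [pow_one]
    omega
  have hN : 2 ≤ n * d * s := calc
    2 ≤ n := hn2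
    _ ≤ n * d := Nat.le_mul_of_pos_right _ hdpos
    _ ≤ n * d * s := Nat.le_mul_of_pos_right _ hspos
  have hnd : n * d ≤ n * d * s := Nat.le_mul_of_pos_right _ hspos
  have hnn : n ≤ n * d := Nat.le_mul_of_pos_right _ hdpos
  have hdn : d ≤ n * d := Nat.le_mul_of_pos_left _ hnpos
  generalize n * d * s = N at hF hN hnd
  have hcard : ∀ x : ℕ, x ≤ N ^ 3 → (x : ℕ∞) ≤ ENat.card F := fun x hx =>
    (Nat.cast_le.2 hx).trans hF
  -- Since `N ≥ 2`, the cube of `N` bounds all three numbers of distinct field elements needed: `n`,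
  -- `n * (d + 1) + 1` and `d * (d + 1) + 1`.
  have hN2 : 2 * N ≤ N ^ 2 := by rw [pow_two]; exact Nat.mul_le_mul_right _ hN
  have hN3 : 2 * N ^ 2 ≤ N ^ 3 := by rw [pow_succ' N 2]; exact Nat.mul_le_mul_right _ hN
  have hcheap := isCheap_of_compEsym (M := s + d + n) hdpos (by omega) (by omega) hd.le
    (hcard _ (by omega)) (hcard _ (by rw [mul_add]; omega)) (hcard _ (by
      have : d * d ≤ N ^ 2 := by rw [pow_two]; exact Nat.mul_le_mul (by omega) (by omega)
      rw [mul_add]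
      omega)) hC (by omega)
  obtain ⟨C', h1, h2, h3⟩ := hcheap.exists_circuit
  exact ⟨C', h1, hbound _ 8 h2 (by norm_num), by omega⟩
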